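/- Let $V$ be a finite set with at least two elements and let $P:V\times V\to[0,\infty)$ have symmetric support, i.e. $P(x,y)>0$ if and only if $P(y,x)>0$ (the sums $\sum_y P(x,y)$ need not equal $1$). Write $x\sim y$ if $P(x,y)>0$, and assume that any two vertices are joined by a finite path $x\sim\dots\sim y$. Let $m$ be the invariant probability measure on $V$, and assume reversibility: $m(x)P(x,y)=m(y)P(y,x)$ for all $x,y\in V$. For $f,g:V\to\mathbb{R}$ put \[ \langle f,g\rangle=\sum_x f(x)g(x)m(x),\qquad \|f\|_2=\sqrt{\langle f,f\rangle},\qquad \Delta f(x)=\sum_y P(x,y)(f(y)-f(x)),\qquad \mathcal E(f,g)=-\langle\Delta f,g\rangle, \] and for $f \ge 0$ with $\sum_x f(x)m(x)=1$ put $\operatorname{Ent}(f)=\langle f,\log f\rangle$, with $0\log 0=0$. The log-Sobolev constant is \[ \alpha=\inf\left\{\frac{\mathcal E(f,f)}{\operatorname{Ent}(f^2)} : f:V\to\mathbb{R},\ \|f\|_2=1,\ \operatorname{Ent}(f^2)>0\right\}. \] For nonempty $X\subset V$ let \[ \lambda_X=\inf\{\mathcal E(f,f): \|f\|_2=1,\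 f=0 \text{ on } X^c\} \] be the smallest Dirichlet eigenvalue of $X$, and for $s,t>0$ let $\theta(s,t)=\frac{s-t}{\log(s/t)}$ if $s\neq t$ and $\theta(s,s)=s$ be the logarithmic mean. The log-spectral constant is \[ \alpha_{\operatorname{spectral}}=\inf\{\theta(\lambda_X,\lambda_{X^c}) : \emptyset\neq X\subsetneq V\}. \] Then there are universal constants $c,C>0$, independent of $V$, $P$ and $m$, such that \[ c\,\alpha\le\alpha_{\operatorname{spectral}}\le C\,\alpha . \] -/

import Mathlib

noncomputable section

/-- A continuous-time Markov chain on the vertex set `V`: nonnegative jump rates `P x y`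
(row sums are not assumed to be one) with symmetric support. -/
structure MarkovChain (V : Type*) where
  P : V → V → ℝ
  nonneg : ∀ x y, 0 ≤ P x y
  symm_support : ∀ x y, 0 < P x y → 0 < P y x

namespace MarkovChain

variable {V : Type*}

/-- The relation `x ∼ y`. -/
def Adj (G : MarkovChain V) (x y : V) : Prop := 0 < G.P x y

/-- Any two vertices are joined by a finite path `x ∼ ⋯ ∼ y`. -/
def Connected (G : MarkovChain V) : Prop :=
  ∀ x y : V, Relation.ReflTransGen G.Adj x y

variable [Fintype V]

/-- `m` is an invariant probability measure of the chain. -/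
structure IsInvariant (G : MarkovChain V) (m : V → ℝ) : Prop where
  nonneg : ∀ x, 0 ≤ m x
  sum_eq_one : ∑ x, m x = 1
  invariant : ∀ x, ∑ y, m x * G.P x y = ∑ y, m y * G.P y x

/-- Detailed balance. -/
def IsReversible (G : MarkovChain V) (m : V → ℝ) : Prop :=
  ∀ x y, m x * G.P x y = m y * G.P y x

/-- The scalar product `⟨f, g⟩ = ∑ x, f x * g x * m x`. -/
def scalar (m : V → ℝ) (f g : V → ℝ) : ℝ := ∑ x, f x * g x * m x

/-- The norm `‖f‖₂` induced by the scalar product. -/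
def norm2 (m : V → ℝ) (f : V → ℝ) : ℝ := √(scalar m f f)

/-- The Laplacian `Δ f x = ∑ y, P x y * (f y - f x)`. -/
def laplacian (G : MarkovChain V) (f : V → ℝ) : V → ℝ :=
  fun x => ∑ y, G.P x y * (f y - f x)

/-- The Dirichlet form `𝓔(f, g) = -⟨Δ f, g⟩`. -/
def dirichletForm (G : MarkovChain V) (m : V → ℝ) (f g : V → ℝ) : ℝ :=
  -scalar m (G.laplacian f) g

/-- The entropy `⟨f, log f⟩` of a nonnegative `f` with `‖f‖₁ = 1`, where `0 log 0 = 0`. -/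
def entropy (m : V → ℝ) (f : V → ℝ) : ℝ := scalar m f (fun x => Real.log (f x))

/-- The log-Sobolev constant, the infimum of `𝓔(f, f) / Ent(f²)` over `‖f‖₂ = 1`; functions
with `Ent(f²) = 0` (for which the quotient is `0 / 0` or infinite) are left out. -/
def logSobolevConst (G : MarkovChain V) (m : V → ℝ) : ℝ :=
  sInf {r : ℝ | ∃ f : V → ℝ, norm2 m f = 1 ∧ 0 < entropy m (fun x => f x ^ 2) ∧
    r = G.dirichletForm m f f / entropy m (fun x => f x ^ 2)}

/-- The smallest Dirichlet eigenvalue `λ_X` of a (nonempty) set `X` of vertices. -/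
def dirichletEigenvalue (G : MarkovChain V) (m : V → ℝ) (X : Set V) : ℝ :=
  sInf {r : ℝ | ∃ f : V → ℝ, norm2 m f = 1 ∧ (∀ x ∈ Xᶜ, f x = 0) ∧
    r = G.dirichletForm m f f}

open Classical in
/-- The logarithmic mean of two positive numbers. -/
def logMean (s t : ℝ) : ℝ := if s = t then s else (s - t) / Real.log (s / t)

/-- The log-spectral constant, the infimum of `θ(λ_X, λ_{Xᶜ})` over the sets `X` for which
both `X` and its complement are nonempty. -/
def logSpectralConst (G : MarkovChain V) (m : V → ℝ) : ℝ :=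
  sInf {r : ℝ | ∃ X : Set V, X.Nonempty ∧ Xᶜ.Nonempty ∧
    r = logMean (G.dirichletEigenvalue m X) (G.dirichletEigenvalue m Xᶜ)}

end MarkovChain

end

/-! Both constants are compared through Faber–Krahn inequalities, which bound energy below by
log(1/mass) for functions of small support.

α ≲ α_spectral: a normalised function supported in X has entropy at least log(1/m(X)), so λ_X ≥ α
log(1/m(X)), and likewise for the complement. As the two masses add up to 1,
`le_logMean_of_mul_neg_log_le` turns the two bounds into α ≤ 4 θ(λ_X, λ_{Xᶜ}).

α_spectral ≲ α: cutting g ≥ 0 of small support at one level τ gives test functions (g - τ)⁺ and (τ -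
g)⁺ for complementary sets, and `logMean_mul_neg_log_le` yields a Faber–Krahn inequality for g
(`logSpectralConst_mul_neg_log_le`). At mass 1/2 this is a Poincaré inequality around a median.
Applied to the dyadic slices of f, whose energies add up to at most that of f, it controls the large
values. The pointwise bound `sq_mul_log_sq_le` splits the entropy into exactly these two
contributions. -/

namespace MarkovChain

variable {V : Type*} [Fintype V]

/-- The squared norm, in the form used for computations. -/
theorem scalar_self (m f : V → ℝ) : scalar m f f = ∑ x, f x ^ 2 * m x := by
  simp only [scalar, sq]

theorem norm2_eq_one_iff (m f : V → ℝ) : norm2 m f = 1 ↔ scalar m f f = 1 := by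
  rw [norm2, Real.sqrt_eq_one]

theorem scalar_self_nonneg {m : V → ℝ} (hm : ∀ x, 0 ≤ m x) (f : V → ℝ) :
    0 ≤ scalar m f f := by
  rw [scalar_self]
  exact Finset.sum_nonneg fun x _ => mul_nonneg (sq_nonneg _) (hm x)

/-- The mass `m(X)`. -/
noncomputable def mass (m : V → ℝ) (X : Set V) : ℝ := ∑ x, X.indicator m x

theorem mass_add_compl (m : V → ℝ) (X : Set V) : mass m X + mass m Xᶜ = ∑ x, m x := by
  rw [mass, mass, ← Finset.sum_add_distrib]
  exact Finset.sum_congr rfl fun x _ => congrFun (Set.indicator_self_add_compl X m) x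

theorem mass_mono {m : V → ℝ} (hm : ∀ x, 0 ≤ m x) {X Y : Set V} (h : X ⊆ Y) :
    mass m X ≤ mass m Y :=
  Finset.sum_le_sum fun _ _ => Set.indicator_le_indicator_of_subset h hm _

theorem mass_pos {m : V → ℝ} (hm : ∀ x, 0 < m x) {X : Set V} (hX : X.Nonempty) :
    0 < mass m X := by
  obtain ⟨x, hx⟩ := hX
  refine Finset.sum_pos' (fun y _ => Set.indicator_nonneg (fun z _ => (hm z).le) y)
    ⟨x, Finset.mem_univ _, ?_⟩
  rw [Set.indicator_of_mem hx]
  exact hm x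

/-- Detailed balance carries positivity of m across each edge, and connectedness does the rest. -/
theorem IsInvariant.pos {G : MarkovChain V} {m : V → ℝ} (hm : G.IsInvariant m)
    (hG : G.Connected) (hr : G.IsReversible m) (x : V) : 0 < m x := by
  obtain ⟨x₀, -, hx₀⟩ : ∃ x ∈ Finset.univ, 0 < m x := by
    apply Finset.exists_lt_of_sum_lt
    simp [hm.sum_eq_one]
  induction hG x₀ x with
  | refl => exact hx₀
  | @tail y z _ hyz ih =>
    have h1 : 0 < m z * G.P z y := by
      rw [← hr y z]
      exact mul_pos ih hyz
    exact pos_of_mul_pos_left h1 (G.nonneg z y)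

/-- The Dirichlet form as a sum over edges. -/
theorem dirichletForm_self {G : MarkovChain V} {m : V → ℝ} (hr : G.IsReversible m) (f : V → ℝ) :
    G.dirichletForm m f f = (∑ x, ∑ y, m x * G.P x y * (f x - f y) ^ 2) / 2 := by
  have h1 : G.dirichletForm m f f = ∑ x, ∑ y, m x * G.P x y * ((f x - f y) * f x) := by
    simp only [dirichletForm, scalar, laplacian, Finset.sum_mul, ← Finset.sum_neg_distrib]
    refine Finset.sum_congr rfl fun x _ => Finset.sum_congr rfl fun y _ => ?_
    ring
  have h2 : G.dirichletForm m f f = ∑ x, ∑ y, m x * G.P x y * ((f y - f x) * f y) := by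
    rw [h1, Finset.sum_comm]
    refine Finset.sum_congr rfl fun x _ => Finset.sum_congr rfl fun y _ => ?_
    rw [hr y x]
  rw [eq_div_iff two_ne_zero, mul_two]
  nth_rewrite 1 [h1]
  rw [h2, ← Finset.sum_add_distrib]
  refine Finset.sum_congr rfl fun x _ => ?_
  rw [← Finset.sum_add_distrib]
  refine Finset.sum_congr rfl fun y _ => ?_
  ring

/-! ### Dirichlet form, Dirichlet eigenvalues, and Faber–Krahn from log-Sobolev. -/

section Energy

variable {G : MarkovChain V} {m : V → ℝ}

theorem dirichletForm_nonneg (hm : ∀ x, 0 ≤ m x) (hr : G.IsReversible m) (f : V → ℝ) :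
    0 ≤ G.dirichletForm m f f := by
  rw [dirichletForm_self hr]
  exact div_nonneg (Finset.sum_nonneg fun x _ => Finset.sum_nonneg fun y _ =>
    mul_nonneg (mul_nonneg (hm x) (G.nonneg x y)) (sq_nonneg _)) zero_le_two

/-- The comparison is edge by edge. Families serve the dyadic slices, single functions serve
truncations and absolute values. -/
theorem sum_dirichletForm_le (hm : ∀ x, 0 ≤ m x) (hr : G.IsReversible m) {ι : Type*}
    (s : Finset ι) (g : ι → V → ℝ) (f : V → ℝ)
    (h : ∀ x y, ∑ i ∈ s, (g i x - g i y) ^ 2 ≤ (f x - f y) ^ 2) :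
    ∑ i ∈ s, G.dirichletForm m (g i) (g i) ≤ G.dirichletForm m f f := by
  simp only [dirichletForm_self hr]
  rw [← Finset.sum_div, Finset.sum_comm]
  gcongr with x
  rw [Finset.sum_comm]
  gcongr with y
  rw [← Finset.mul_sum]
  exact mul_le_mul_of_nonneg_left (h x y) (mul_nonneg (hm x) (G.nonneg x y))

theorem dirichletForm_le_of_abs_sub_le (hm : ∀ x, 0 ≤ m x) (hr : G.IsReversible m)
    {g f : V → ℝ} (h : ∀ x y, |g x - g y| ≤ |f x - f y|) :
    G.dirichletForm m g g ≤ G.dirichletForm m f f := by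
  have := sum_dirichletForm_le hm hr {()} (fun _ => g) f
    (fun x y => by simpa using sq_le_sq.2 (h x y))
  simpa using this

theorem scalar_smul_self (c : ℝ) (f : V → ℝ) :
    scalar m (fun x => c * f x) (fun x => c * f x) = c ^ 2 * scalar m f f := by
  rw [scalar_self, scalar_self, Finset.mul_sum]
  exact Finset.sum_congr rfl fun x _ => by ring

theorem dirichletForm_smul_self (hr : G.IsReversible m) (c : ℝ) (f : V → ℝ) :
    G.dirichletForm m (fun x => c * f x) (fun x => c * f x) =
      c ^ 2 * G.dirichletForm m f f := by
  rw [dirichletForm_self hr, dirichletForm_self hr, ← mul_div_assoc, Finset.mul_sum]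
  simp only [Finset.mul_sum]
  congr 1
  exact Finset.sum_congr rfl fun x _ => Finset.sum_congr rfl fun y _ => by ring

theorem dirichletEigenvalue_nonneg (hm : ∀ x, 0 ≤ m x) (hr : G.IsReversible m) (X : Set V) :
    0 ≤ G.dirichletEigenvalue m X := by
  apply Real.sInf_nonneg
  rintro r ⟨f, -, -, rfl⟩
  exact dirichletForm_nonneg hm hr f

theorem dirichletEigenvalue_mul_le (hm : ∀ x, 0 ≤ m x) (hr : G.IsReversible m) {X : Set V}
    {f : V → ℝ} (hf : ∀ x ∈ Xᶜ, f x = 0) :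
    G.dirichletEigenvalue m X * scalar m f f ≤ G.dirichletForm m f f := by
  rcases (scalar_self_nonneg hm f).eq_or_lt with h0 | h0
  · rw [← h0, mul_zero]
    exact dirichletForm_nonneg hm hr f
  rw [← le_div_iff₀ h0]
  refine csInf_le ⟨0, ?_⟩ ⟨fun x => (√(scalar m f f))⁻¹ * f x, ?_, ?_, ?_⟩
  · rintro r ⟨g, -, -, rfl⟩
    exact dirichletForm_nonneg hm hr g
  · rw [norm2_eq_one_iff, scalar_smul_self, inv_pow, Real.sq_sqrt h0.le, inv_mul_cancel₀ h0.ne']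
  · intro x hx
    simp only [hf x hx, mul_zero]
  · rw [dirichletForm_smul_self hr, inv_pow, Real.sq_sqrt h0.le]
    ring

theorem exists_norm2_eq_one (hm : ∀ x, 0 < m x) {X : Set V} (hX : X.Nonempty) :
    ∃ f : V → ℝ, norm2 m f = 1 ∧ ∀ x ∈ Xᶜ, f x = 0 := by
  classical
  obtain ⟨x₀, hx₀⟩ := hX
  refine ⟨fun x => (√(m x₀))⁻¹ * (if x = x₀ then 1 else 0), ?_, fun x hx => ?_⟩
  · rw [norm2_eq_one_iff, scalar_smul_self, inv_pow, Real.sq_sqrt (hm x₀).le, scalar_self]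
    simp [(hm x₀).ne']
  · have : x ≠ x₀ := fun h => hx (h ▸ hx₀)
    simp [this]

/-- A function supported in `X` has entropy at least `log (1 / m(X))`. -/
theorem neg_log_mass_le_entropy (hm : ∀ x, 0 < m x) {X : Set V} (hX : X.Nonempty) {f : V → ℝ}
    (hf : norm2 m f = 1) (hfX : ∀ x ∈ Xᶜ, f x = 0) :
    -Real.log (mass m X) ≤ entropy m (fun x => f x ^ 2) := by
  rw [norm2_eq_one_iff, scalar_self] at hf
  have hp := mass_pos hm hX
  set p := mass m X with hpdef
  -- Jensen done pointwise: log t ≥ 1 - 1/t at t = f(x)² p. After summation the left side vanishes.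
  have key : ∀ x, f x ^ 2 * m x - p⁻¹ * X.indicator m x ≤
      f x ^ 2 * Real.log (f x ^ 2) * m x + Real.log p * (f x ^ 2 * m x) := by
    intro x
    by_cases hx : x ∈ X
    · rw [Set.indicator_of_mem hx]
      by_cases h0 : f x = 0
      · have : 0 < p⁻¹ * m x := mul_pos (inv_pos.2 hp) (hm x)
        simp [h0, this.le]
      · have h1 : 0 < f x ^ 2 := by positivity
        have h2 := Real.one_sub_inv_le_log_of_pos (mul_pos h1 hp)
        rw [Real.log_mul h1.ne' hp.ne'] at h2
        have h3 := mul_le_mul_of_nonneg_left h2 (mul_pos h1 (hm x)).le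
        have h4 : f x ^ 2 * m x * (1 - (f x ^ 2 * p)⁻¹) = f x ^ 2 * m x - p⁻¹ * m x := by
          field_simp
        rw [h4] at h3
        linarith
    · rw [Set.indicator_of_notMem hx, hfX x hx]
      simp
  have hsum := Finset.sum_le_sum fun x (_ : x ∈ Finset.univ) => key x
  rw [Finset.sum_sub_distrib, Finset.sum_add_distrib, ← Finset.mul_sum, ← Finset.mul_sum, hf,
    show ∑ x, X.indicator m x = p from rfl, inv_mul_cancel₀ hp.ne'] at hsum
  simp only [entropy, scalar]
  linarith

theorem logSobolevConst_mul_le (hm : ∀ x, 0 < m x) (hr : G.IsReversible m)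
    {f : V → ℝ} (hf : norm2 m f = 1) (hpos : 0 < entropy m (fun x => f x ^ 2)) :
    G.logSobolevConst m * entropy m (fun x => f x ^ 2) ≤ G.dirichletForm m f f := by
  rw [← le_div_iff₀ hpos]
  refine csInf_le ⟨0, ?_⟩ ⟨f, hf, hpos, rfl⟩
  rintro r ⟨g, -, hg, rfl⟩
  exact div_nonneg (dirichletForm_nonneg (fun x => (hm x).le) hr g) hg.le

theorem logSobolevConst_nonneg (hm : ∀ x, 0 ≤ m x) (hr : G.IsReversible m) :
    0 ≤ G.logSobolevConst m := by
  apply Real.sInf_nonneg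
  rintro r ⟨g, -, hg, rfl⟩
  exact div_nonneg (dirichletForm_nonneg hm hr g) hg.le

/-- The Faber–Krahn inequality implied by the log-Sobolev inequality. -/
theorem logSobolevConst_mul_neg_log_mass_le (hm : ∀ x, 0 < m x) (hr : G.IsReversible m)
    {X : Set V} (hX : X.Nonempty) (hX1 : mass m X < 1) :
    G.logSobolevConst m * -Real.log (mass m X) ≤ G.dirichletEigenvalue m X := by
  obtain ⟨f₀, hf₀, hf₀X⟩ := exists_norm2_eq_one hm hX
  refine le_csInf ⟨_, f₀, hf₀, hf₀X, rfl⟩ ?_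
  rintro r ⟨f, hf, hfX, rfl⟩
  have h1 := neg_log_mass_le_entropy hm hX hf hfX
  have h2 : 0 < -Real.log (mass m X) := neg_pos.2 (Real.log_neg (mass_pos hm hX) hX1)
  exact (mul_le_mul_of_nonneg_left h1 (logSobolevConst_nonneg (fun x => (hm x).le) hr)).trans
    (logSobolevConst_mul_le hm hr hf (h2.trans_le h1))

end Energy

/-! ### Estimates for the logarithmic mean. -/

section LogMean

theorem logMean_comm (s t : ℝ) : logMean s t = logMean t s := by
  unfold logMean
  by_cases h : s = t
  · simp [h]
  · rw [if_neg h, if_neg (Ne.symm h), ← inv_div t s, Real.log_inv, ← neg_sub t s, neg_div_neg_eq]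

/-- The conventions x / 0 = 0 and log 0 = 0 produce the limiting value of the mean, so positivity of
the eigenvalues is never needed. -/
theorem logMean_zero_right (s : ℝ) : logMean s 0 = 0 := by
  unfold logMean
  split_ifs with h <;> simp [h]

theorem logMean_of_lt {s t : ℝ} (h : t < s) : logMean s t = (s - t) / Real.log (s / t) :=
  if_neg h.ne'

theorem log_div_pos {s t : ℝ} (ht : 0 < t) (h : t < s) : 0 < Real.log (s / t) :=
  Real.log_pos ((one_lt_div ht).2 h)

theorem logMean_nonneg_of_le {s t : ℝ} (ht : 0 ≤ t) (h : t ≤ s) : 0 ≤ logMean s t := by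
  rcases ht.eq_or_lt with rfl | ht
  · rw [logMean_zero_right]
  rcases h.eq_or_lt with rfl | h
  · simp [logMean, ht.le]
  · rw [logMean_of_lt h]
    exact div_nonneg (sub_nonneg.2 h.le) (log_div_pos ht h).le

theorem logMean_nonneg {s t : ℝ} (hs : 0 ≤ s) (ht : 0 ≤ t) : 0 ≤ logMean s t := by
  rcases le_total t s with h | h
  · exact logMean_nonneg_of_le ht h
  · rw [logMean_comm]
    exact logMean_nonneg_of_le hs h

theorem logMean_le_left {s t : ℝ} (ht : 0 ≤ t) (h : t ≤ s) : logMean s t ≤ s := by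
  rcases ht.eq_or_lt with rfl | ht
  · rwa [logMean_zero_right]
  rcases h.eq_or_lt with rfl | h
  · simp [logMean]
  have hs := ht.trans h
  rw [logMean_of_lt h, div_le_iff₀ (log_div_pos ht h)]
  have h1 := Real.one_sub_inv_le_log_of_pos (div_pos hs ht)
  rw [inv_div] at h1
  calc s - t = s * (1 - t / s) := by field_simp
    _ ≤ s * Real.log (s / t) := mul_le_mul_of_nonneg_left h1 hs.le

theorem logMean_le_max {s t : ℝ} (hs : 0 ≤ s) (ht : 0 ≤ t) : logMean s t ≤ max s t := by
  rcases le_total t s with h | h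
  · exact (logMean_le_left ht h).trans (le_max_left _ _)
  · rw [logMean_comm]
    exact (logMean_le_left hs h).trans (le_max_right _ _)

theorem right_le_logMean {s t : ℝ} (ht : 0 ≤ t) (h : t ≤ s) : t ≤ logMean s t := by
  rcases ht.eq_or_lt with rfl | ht
  · rw [logMean_zero_right]
  rcases h.eq_or_lt with rfl | h
  · simp [logMean]
  rw [logMean_of_lt h, le_div_iff₀ (log_div_pos ht h)]
  have h1 := Real.log_le_sub_one_of_pos (div_pos (ht.trans h) ht)
  calc t * Real.log (s / t) ≤ t * (s / t - 1) := mul_le_mul_of_nonneg_left h1 ht.le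
    _ = s - t := by field_simp

theorem sqrt_mul_neg_log_le {p : ℝ} (hp : 0 < p) : √p * -Real.log p ≤ 2 := by
  have hq := Real.sqrt_pos.2 hp
  have h1 := Real.one_sub_inv_le_log_of_pos hq
  rw [Real.log_sqrt hp.le] at h1
  have h2 : -Real.log p ≤ 2 * (√p)⁻¹ := by linarith
  calc √p * -Real.log p ≤ √p * (2 * (√p)⁻¹) := mul_le_mul_of_nonneg_left h2 hq.le
    _ = 2 := by field_simp

/-- If t ≤ √p s, then log(s/t) ≥ ½ log(1/p) and the product is at most 2s. Otherwise s and t are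
both at most 8√p e, and √p log(1/p) ≤ 2 absorbs the logarithm. -/
theorem logMean_mul_neg_log_le {s t e p : ℝ} (hs : 0 ≤ s) (ht : 0 ≤ t) (he : 0 ≤ e)
    (hp : 0 < p) (hp1 : p ≤ 1 / 2) (hse : s ≤ 4 * e) (hte : t ≤ 8 * p * e) :
    logMean s t * -Real.log p ≤ 16 * e := by
  rcases ht.eq_or_lt with rfl | ht
  · rw [logMean_zero_right]
    linarith
  have hq := Real.sqrt_pos.2 hp
  have hqq : √p * √p = p := Real.mul_self_sqrt hp.le
  have hq1 : √p < 1 := by nlinarith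
  have hlog : 0 < -Real.log p := neg_pos.2 (Real.log_neg hp (by linarith))
  rcases le_or_gt t (√p * s) with h | h
  · have hs0 : 0 < s := by
      by_contra hs0
      nlinarith
    have hts : t < s := by nlinarith
    have hL := log_div_pos ht hts
    have h1 : (√p)⁻¹ ≤ s / t := by
      rw [inv_eq_one_div, div_le_div_iff₀ hq ht]
      linarith
    have h2 := Real.log_le_log (inv_pos.2 hq) h1
    rw [Real.log_inv, Real.log_sqrt hp.le] at h2
    rw [logMean_of_lt hts, div_mul_eq_mul_div, div_le_iff₀ hL]
    have h3 : -Real.log p ≤ 2 * Real.log (s / t) := by linarith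
    have h4 : (s - t) * -Real.log p ≤ s * (2 * Real.log (s / t)) :=
      mul_le_mul (by linarith) h3 hlog.le hs0.le
    nlinarith
  · have h1 : s ≤ 8 * √p * e := by
      have : √p * s ≤ √p * (8 * √p * e) := by nlinarith
      exact le_of_mul_le_mul_left this hq
    have h2 : t ≤ 8 * √p * e := by
      have : p ≤ √p := by nlinarith
      nlinarith
    have h3 := (logMean_le_max hs ht.le).trans (max_le h1 h2)
    calc logMean s t * -Real.log p ≤ 8 * √p * e * -Real.log p :=
          mul_le_mul_of_nonneg_right h3 hlog.le
      _ = 8 * e * (√p * -Real.log p) := by ring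
      _ ≤ 8 * e * 2 := mul_le_mul_of_nonneg_left (sqrt_mul_neg_log_le hp) (by positivity)
      _ = 16 * e := by ring

/-- Since log(1/q) ≥ 1 - q = p, also t ≥ ap, and similarly s ≥ aq. If s ≤ 2t, adding gives a ≤ 3t.
Otherwise s ≤ 2(s - t), so a log(s/t) ≤ 2s suffices: for p ≤ √(t/s) the first bound gives it, and
for larger p, t ≥ ap forces a ≤ √(st). -/
theorem le_logMean_of_mul_neg_log_le {a s t p q : ℝ} (ha : 0 ≤ a) (ht : 0 ≤ t)
    (hts : t ≤ s) (hp : 0 < p) (hq : 0 < q) (hpq : p + q = 1)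
    (h1 : a * -Real.log p ≤ s) (h2 : a * -Real.log q ≤ t) : a ≤ 4 * logMean s t := by
  have hlq : p ≤ -Real.log q := by
    have := Real.log_le_sub_one_of_pos hq
    linarith
  have hlp : q ≤ -Real.log p := by
    have := Real.log_le_sub_one_of_pos hp
    linarith
  have hap : a * p ≤ t := (mul_le_mul_of_nonneg_left hlq ha).trans h2
  have haq : a * q ≤ s := (mul_le_mul_of_nonneg_left hlp ha).trans h1
  rcases ht.eq_or_lt with rfl | ht
  · rw [logMean_zero_right]
    have : a ≤ 0 := by
      by_contra h
      have := mul_pos (not_le.1 h) hp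
      linarith
    linarith
  rcases le_or_gt s (2 * t) with hst | hst
  · have h3 := right_le_logMean ht.le hts
    have h4 : a = a * p + a * q := by rw [← mul_add, hpq, mul_one]
    linarith
  have hs : 0 < s := by linarith
  have hlt : t < s := by linarith
  have hL := log_div_pos ht hlt
  rw [logMean_of_lt hlt, ← mul_div_assoc, le_div_iff₀ hL]
  have hr : 0 < t / s := div_pos ht hs
  have hlogr : Real.log (s / t) = -Real.log (t / s) := by rw [← Real.log_inv, inv_div]
  rcases le_or_gt p √(t / s) with h | h
  · have h3 := Real.log_le_log hp h
    rw [Real.log_sqrt hr.le] at h3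
    have h4 : Real.log (s / t) ≤ 2 * -Real.log p := by linarith
    have h5 := mul_le_mul_of_nonneg_left h4 ha
    linarith
  · have h3 : a * √(t / s) ≤ t := (mul_le_mul_of_nonneg_left h.le ha).trans hap
    have h4 := sqrt_mul_neg_log_le hr
    rw [← hlogr] at h4
    have hsq := Real.sqrt_pos.2 hr
    have h5 : √(t / s) * √(t / s) * s = t := by
      rw [Real.mul_self_sqrt hr.le]
      field_simp
    have h6 : a ≤ √(t / s) * s := by
      refine le_of_mul_le_mul_right ?_ hsq
      linarith
    calc a * Real.log (s / t) ≤ √(t / s) * s * Real.log (s / t) :=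
          mul_le_mul_of_nonneg_right h6 hL.le
      _ = s * (√(t / s) * Real.log (s / t)) := by ring
      _ ≤ s * 2 := mul_le_mul_of_nonneg_left h4 hs.le
      _ ≤ 4 * (s - t) := by linarith

end LogMean

/-! ### Comparison of the two constants, starting with α ≤ 4 α_spectral. -/

section Comparison

variable {G : MarkovChain V} {m : V → ℝ}

theorem logSobolevConst_le_logSpectralConst [Nontrivial V] (hm : ∀ x, 0 < m x)
    (hm1 : ∑ x, m x = 1) (hr : G.IsReversible m) :
    G.logSobolevConst m ≤ 4 * G.logSpectralConst m := by
  have hm0 : ∀ x, 0 ≤ m x := fun x => (hm x).le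
  obtain ⟨x, y, hxy⟩ := exists_pair_ne V
  suffices G.logSobolevConst m / 4 ≤ G.logSpectralConst m by linarith
  refine le_csInf ⟨_, {x}, ⟨x, rfl⟩, ⟨y, hxy.symm⟩, rfl⟩ ?_
  rintro r ⟨X, hX, hX', rfl⟩
  have hp := mass_pos hm hX
  have hq := mass_pos hm hX'
  have hpq := (mass_add_compl m X).trans hm1
  have ha := logSobolevConst_nonneg hm0 hr
  have h1 := logSobolevConst_mul_neg_log_mass_le hm hr hX (by linarith)
  have h2 := logSobolevConst_mul_neg_log_mass_le hm hr hX' (by linarith)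
  have hs := dirichletEigenvalue_nonneg hm0 hr X
  have ht := dirichletEigenvalue_nonneg hm0 hr Xᶜ
  rcases le_total (G.dirichletEigenvalue m Xᶜ) (G.dirichletEigenvalue m X) with h | h
  · linarith [le_logMean_of_mul_neg_log_le ha ht h hp hq hpq h1 h2]
  · rw [logMean_comm]
    linarith [le_logMean_of_mul_neg_log_le ha hs h hq hp (by linarith) h2 h1]

theorem logSpectralConst_nonneg (hm : ∀ x, 0 ≤ m x) (hr : G.IsReversible m) :
    0 ≤ G.logSpectralConst m := by
  apply Real.sInf_nonneg
  rintro r ⟨X, -, -, rfl⟩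
  exact logMean_nonneg (dirichletEigenvalue_nonneg hm hr _) (dirichletEigenvalue_nonneg hm hr _)

theorem logSpectralConst_le (hm : ∀ x, 0 ≤ m x) (hr : G.IsReversible m) {X : Set V}
    (hX : X.Nonempty) (hX' : Xᶜ.Nonempty) :
    G.logSpectralConst m ≤
      logMean (G.dirichletEigenvalue m X) (G.dirichletEigenvalue m Xᶜ) := by
  refine csInf_le ⟨0, ?_⟩ ⟨X, hX, hX', rfl⟩
  rintro r ⟨Y, -, -, rfl⟩
  exact logMean_nonneg (dirichletEigenvalue_nonneg hm hr _) (dirichletEigenvalue_nonneg hm hr _)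

/-! ### Truncation and Faber–Krahn from the log-spectral constant. -/

theorem abs_max_sub_max_le (a b c : ℝ) : |max (a - c) 0 - max (b - c) 0| ≤ |a - b| := by
  simpa using abs_max_sub_max_le_abs (a - c) (b - c) 0

theorem abs_max_sub_max_le' (a b c : ℝ) : |max (c - a) 0 - max (c - b) 0| ≤ |a - b| := by
  have := abs_max_sub_max_le_abs (c - a) (c - b) 0
  rwa [sub_sub_sub_cancel_left, abs_sub_comm b a] at this

/-- The Faber–Krahn inequality implied by the log-spectral constant. -/
theorem logSpectralConst_mul_neg_log_le (hm : ∀ x, 0 ≤ m x) (hm1 : ∑ x, m x = 1)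
    (hr : G.IsReversible m) {g : V → ℝ} (hg : ∀ x, 0 ≤ g x) {p : ℝ} (hp : 0 < p)
    (hp1 : p ≤ 1 / 2) (hgp : mass m {x | 0 < g x} ≤ p) :
    G.logSpectralConst m * -Real.log p * scalar m g g ≤ 16 * G.dirichletForm m g g := by
  have hE := dirichletForm_nonneg hm hr g
  rcases (scalar_self_nonneg hm g).eq_or_lt with h0 | h0
  · rw [← h0, mul_zero]
    linarith
  set N := scalar m g g with hN
  -- Chosen so that 2τ²p = N/2: by g² ≤ 2u² + 2τ² on {g > 0}, u keeps N/4 of the squared norm.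
  -- Meanwhile v = τ on {g = 0}, of mass at least 1/2, so its squared norm is at least τ²/2 =
  -- N/(8p).
  set τ := √(N / (4 * p)) with hτdef
  have hτ : 0 < τ := Real.sqrt_pos.2 (by positivity)
  have hτ2 : τ ^ 2 = N / (4 * p) := Real.sq_sqrt (by positivity)
  set Y : Set V := {x | τ < g x} with hY
  set u : V → ℝ := fun x => max (g x - τ) 0 with hu
  set v : V → ℝ := fun x => max (τ - g x) 0 with hv
  have huN : N / 4 ≤ scalar m u u := by
    have key : ∀ x, g x ^ 2 * m x ≤
        2 * (u x ^ 2 * m x) + 2 * τ ^ 2 * Set.indicator {x | 0 < g x} m x := by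
      intro x
      by_cases hx : 0 < g x
      · rw [Set.indicator_of_mem (show x ∈ {x | 0 < g x} from hx)]
        have : g x ^ 2 ≤ 2 * u x ^ 2 + 2 * τ ^ 2 := by
          simp only [hu]
          rcases max_cases (g x - τ) 0 with ⟨h, h'⟩ | ⟨h, h'⟩ <;> rw [h] <;>
            nlinarith [sq_nonneg (g x - 2 * τ)]
        nlinarith [hm x]
      · have hx0 : g x = 0 := le_antisymm (not_lt.1 hx) (hg x)
        rw [Set.indicator_of_notMem (show x ∉ {x | 0 < g x} from hx), hx0]
        have := mul_nonneg (sq_nonneg (u x)) (hm x)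
        linarith
    have hsum := Finset.sum_le_sum fun x (_ : x ∈ Finset.univ) => key x
    rw [Finset.sum_add_distrib, ← Finset.mul_sum, ← Finset.mul_sum, ← scalar_self,
      ← scalar_self, show ∑ x, Set.indicator {x | 0 < g x} m x = mass m {x | 0 < g x} from rfl]
      at hsum
    have h1 : 2 * τ ^ 2 * mass m {x | 0 < g x} ≤ 2 * τ ^ 2 * p :=
      mul_le_mul_of_nonneg_left hgp (by positivity)
    have h2 : 2 * τ ^ 2 * p = N / 2 := by
      rw [hτ2]
      field_simp
      norm_num
    linarith
  have hvN : N / (8 * p) ≤ scalar m v v := by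
    have key : ∀ x, τ ^ 2 * Set.indicator {x | 0 < g x}ᶜ m x ≤ v x ^ 2 * m x := by
      intro x
      by_cases hx : 0 < g x
      · rw [Set.indicator_of_notMem (show x ∉ {x | 0 < g x}ᶜ from fun h => h hx), mul_zero]
        exact mul_nonneg (sq_nonneg _) (hm x)
      · have hx0 : g x = 0 := le_antisymm (not_lt.1 hx) (hg x)
        rw [Set.indicator_of_mem (show x ∈ {x | 0 < g x}ᶜ from hx)]
        simp [hv, hx0, hτ.le]
    have hsum := Finset.sum_le_sum fun x (_ : x ∈ Finset.univ) => key x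
    rw [← Finset.mul_sum, ← scalar_self,
      show ∑ x, Set.indicator {x | 0 < g x}ᶜ m x = mass m {x | 0 < g x}ᶜ from rfl] at hsum
    have h1 := (mass_add_compl m {x | 0 < g x}).trans hm1
    have h2 : τ ^ 2 * (1 / 2) ≤ τ ^ 2 * mass m {x | 0 < g x}ᶜ :=
      mul_le_mul_of_nonneg_left (by linarith) (by positivity)
    have h3 : τ ^ 2 * (1 / 2) = N / (8 * p) := by
      rw [hτ2]
      field_simp
      norm_num
    linarith
  have huY : ∀ x ∈ Yᶜ, u x = 0 := fun x hx =>
    max_eq_right (sub_nonpos.2 (not_lt.1 hx))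
  have hvY : ∀ x ∈ Yᶜᶜ, v x = 0 := fun x hx => by
    rw [compl_compl] at hx
    exact max_eq_right (sub_nonpos.2 (le_of_lt hx))
  have hYne : Y.Nonempty := by
    by_contra h
    have : scalar m u u = 0 := by
      rw [scalar_self]
      refine Finset.sum_eq_zero fun x _ => ?_
      rw [huY x fun hx => h ⟨x, hx⟩]
      simp
    linarith
  have hYne' : Yᶜ.Nonempty := by
    by_contra h
    have : scalar m v v = 0 := by
      rw [scalar_self]
      refine Finset.sum_eq_zero fun x _ => ?_
      rw [hvY x fun hx => h ⟨x, hx⟩]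
      simp
    have : 0 < N / (8 * p) := by positivity
    linarith
  have hs0 := dirichletEigenvalue_nonneg hm hr Y
  have ht0 := dirichletEigenvalue_nonneg hm hr Yᶜ
  have hs : G.dirichletEigenvalue m Y ≤ 4 * (G.dirichletForm m g g / N) := by
    have h1 := (dirichletEigenvalue_mul_le hm hr huY).trans
      (dirichletForm_le_of_abs_sub_le hm hr fun x y => abs_max_sub_max_le (g x) (g y) τ)
    have h2 := (mul_le_mul_of_nonneg_left huN hs0).trans h1
    rw [← mul_div_assoc, le_div_iff₀ h0]
    linarith
  have ht : G.dirichletEigenvalue m Yᶜ ≤ 8 * p * (G.dirichletForm m g g / N) := by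
    have h1 := (dirichletEigenvalue_mul_le hm hr hvY).trans
      (dirichletForm_le_of_abs_sub_le hm hr fun x y => abs_max_sub_max_le' (g x) (g y) τ)
    have h2 := (mul_le_mul_of_nonneg_left hvN ht0).trans h1
    rw [← mul_div_assoc, div_le_iff₀ (by positivity)] at h2
    rw [← mul_div_assoc, le_div_iff₀ h0]
    linarith
  have hlog : 0 ≤ -Real.log p := neg_nonneg.2 (Real.log_nonpos hp.le (by linarith))
  have h1 := (mul_le_mul_of_nonneg_right (logSpectralConst_le hm hr hYne hYne') hlog).trans
    (logMean_mul_neg_log_le hs0 ht0 (div_nonneg hE h0.le) hp hp1 hs ht)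
  rwa [← mul_div_assoc, le_div_iff₀ h0] at h1

/-! ### Median and Poincaré inequality. -/

theorem exists_median [Nonempty V] (hm : ∀ x, 0 ≤ m x) (hm1 : ∑ x, m x = 1) (f : V → ℝ) :
    ∃ a : ℝ, mass m {x | a < f x} ≤ 1 / 2 ∧ mass m {x | f x < a} ≤ 1 / 2 := by
  classical
  let S : Finset V := {x | mass m {y | f x < f y} ≤ 1 / 2}
  have hS : S.Nonempty := by
    obtain ⟨x, hx⟩ := Finite.exists_max f
    refine ⟨x, ?_⟩
    have : {y | f x < f y} = ∅ := by
      ext y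
      simpa using hx y
    simp [S, this, mass]
  -- The least value of f whose strict superlevel set has mass at most 1/2. The next smaller value,
  -- if any, violates this bound, so the complement of its superlevel set is light.
  obtain ⟨x₀, hx₀, hmin⟩ := S.exists_min_image f hS
  refine ⟨f x₀, by simpa [S] using hx₀, ?_⟩
  let T : Finset V := {x | f x < f x₀}
  rcases T.eq_empty_or_nonempty with hT | hT
  · have : {x | f x < f x₀} = ∅ := by
      ext y
      have : y ∉ T := by simp [hT]
      simpa [T] using this
    simp [this, mass]
  · obtain ⟨y, hy, hmax⟩ := T.exists_max_image f hT
    have hy' : f y < f x₀ := by simpa [T] using hy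
    have hyS : ¬ mass m {z | f y < f z} ≤ 1 / 2 := by
      intro h
      have := hmin y (by simpa [S] using h)
      linarith
    have hsub : {x | f x < f x₀} ⊆ {z | f y < f z}ᶜ := fun z hz =>
      not_lt.2 (hmax z (by simpa [T] using hz))
    have h1 := mass_mono hm hsub
    have h2 := (mass_add_compl m {z | f y < f z}).trans hm1
    linarith [not_le.1 hyS]

/-- The Poincaré inequality around a median. -/
theorem logSpectralConst_mul_variance_le [Nonempty V] (hm : ∀ x, 0 ≤ m x) (hm1 : ∑ x, m x = 1)
    (hr : G.IsReversible m) (f : V → ℝ) :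
    ∃ a : ℝ, G.logSpectralConst m * ∑ x, (f x - a) ^ 2 * m x ≤ 64 * G.dirichletForm m f f := by
  obtain ⟨a, ha, ha'⟩ := exists_median hm hm1 f
  refine ⟨a, ?_⟩
  have hlog : 1 / 2 ≤ -Real.log (1 / 2) := by
    rw [one_div, Real.log_inv, neg_neg]
    linarith [Real.log_two_gt_d9]
  have hκ := logSpectralConst_nonneg hm hr
  have aux : ∀ g : V → ℝ, (∀ x, 0 ≤ g x) → mass m {x | 0 < g x} ≤ 1 / 2 →
      (∀ x y, |g x - g y| ≤ |f x - f y|) →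
      G.logSpectralConst m * scalar m g g ≤ 32 * G.dirichletForm m f f := by
    intro g hg hgp hgf
    have h1 := logSpectralConst_mul_neg_log_le hm hm1 hr hg one_half_pos le_rfl hgp
    have h2 := dirichletForm_le_of_abs_sub_le hm hr hgf
    have h3 := mul_le_mul_of_nonneg_left hlog
      (mul_nonneg hκ (scalar_self_nonneg hm g))
    linarith
  have h1 := aux (fun x => max (f x - a) 0) (fun x => le_max_right _ _) (by simpa using ha)
    (fun x y => abs_max_sub_max_le _ _ _)
  have h2 := aux (fun x => max (a - f x) 0) (fun x => le_max_right _ _) (by simpa using ha')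
    (fun x y => abs_max_sub_max_le' _ _ _)
  have h3 : ∑ x, (f x - a) ^ 2 * m x = scalar m (fun x => max (f x - a) 0)
      (fun x => max (f x - a) 0) + scalar m (fun x => max (a - f x) 0)
      (fun x => max (a - f x) 0) := by
    rw [scalar_self, scalar_self, ← Finset.sum_add_distrib]
    refine Finset.sum_congr rfl fun x _ => ?_
    rcases le_total (f x) a with h | h
    · rw [max_eq_right (sub_nonpos.2 h), max_eq_left (sub_nonneg.2 h)]
      ring
    · rw [max_eq_left (sub_nonneg.2 h), max_eq_right (sub_nonpos.2 h)]
      ring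
  rw [h3, mul_add]
  linarith

/-! ### Dyadic slicing and the log-Sobolev inequality. -/

/-- The part of `u` between the dyadic levels `2 ^ k` and `2 ^ (k + 1)`. -/
noncomputable def slice (k : ℕ) (u : ℝ) : ℝ := min u (2 ^ (k + 1)) - min u (2 ^ k)

theorem slice_nonneg (k : ℕ) (u : ℝ) : 0 ≤ slice k u :=
  sub_nonneg.2 (min_le_min le_rfl (pow_le_pow_right₀ one_le_two k.le_succ))

theorem slice_mono (k : ℕ) : Monotone (slice k) := by
  intro u v h
  have h1 : (2 : ℝ) ^ k ≤ 2 ^ (k + 1) := pow_le_pow_right₀ one_le_two k.le_succ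
  unfold slice
  rcases min_cases u (2 ^ (k + 1)) with h2 | h2 <;> rcases min_cases u (2 ^ k) with h3 | h3 <;>
  rcases min_cases v (2 ^ (k + 1)) with h4 | h4 <;> rcases min_cases v (2 ^ k) with h5 | h5 <;>
  linarith

theorem slice_pos_iff (k : ℕ) (u : ℝ) : 0 < slice k u ↔ 2 ^ k < u := by
  have h1 : (2 : ℝ) ^ k < 2 ^ (k + 1) := pow_lt_pow_right₀ one_lt_two k.lt_succ_self
  unfold slice
  rcases min_cases u (2 ^ (k + 1)) with h2 | h2 <;> rcases min_cases u (2 ^ k) with h3 | h3 <;>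
  constructor <;> intro h <;> linarith

theorem slice_of_le {k : ℕ} {u : ℝ} (h : 2 ^ (k + 1) ≤ u) : slice k u = 2 ^ k := by
  have h1 : (2 : ℝ) ^ k ≤ 2 ^ (k + 1) := pow_le_pow_right₀ one_le_two k.le_succ
  rw [slice, min_eq_right h, min_eq_right (h1.trans h), pow_succ]
  ring

/-- Slices are monotone, so all increments have one sign. The sum of squares is then at most the
square of the sum, which telescopes. -/
theorem sum_slice_sub_sq_le (K : ℕ) (u v : ℝ) :
    ∑ k ∈ Finset.range K, (slice k u - slice k v) ^ 2 ≤ (u - v) ^ 2 := by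
  wlog h : v ≤ u generalizing u v
  · have := this v u (le_of_not_ge h)
    simpa only [sub_sq_comm v u, fun k => sub_sq_comm (slice k v) (slice k u)] using this
  have h0 : ∀ k ∈ Finset.range K, 0 ≤ slice k u - slice k v := fun k _ =>
    sub_nonneg.2 (slice_mono k h)
  refine (Finset.sum_sq_le_sq_sum_of_nonneg h0).trans ?_
  refine pow_le_pow_left₀ (Finset.sum_nonneg h0) ?_ 2
  rw [Finset.sum_sub_distrib]
  simp only [slice]
  rw [Finset.sum_range_sub (fun k => min u ((2 : ℝ) ^ k)),
    Finset.sum_range_sub (fun k => min v ((2 : ℝ) ^ k))]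
  have h1 : min v (2 ^ 0) ≤ min u (2 ^ 0) := min_le_min h le_rfl
  rcases min_cases u (2 ^ K) with h2 | h2 <;> rcases min_cases v (2 ^ K) with h3 | h3 <;>
  linarith

/-- The left side integrates to the entropy when f² and m have total mass 1. Below 4, log u ≤ u - 1
bounds it by (u - 1)²(2u + 1); above 4, a single slice is enough. -/
theorem sq_mul_log_sq_le {K : ℕ} {u : ℝ} (hu : 0 ≤ u) (huK : u < 2 ^ K) :
    u ^ 2 * Real.log (u ^ 2) - u ^ 2 + 1 ≤
      9 * (u - 1) ^ 2 + 96 * ∑ k ∈ Finset.range K, k * slice k u ^ 2 := by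
  have hS : ∀ k ∈ Finset.range K, 0 ≤ (k : ℝ) * slice k u ^ 2 := fun k _ => by positivity
  rcases hu.eq_or_lt with rfl | hu0
  · have := Finset.sum_nonneg hS
    norm_num
    linarith
  rcases lt_or_ge u 4 with h4 | h4
  · have h1 := Real.log_le_sub_one_of_pos hu0
    have h2 : u ^ 2 * Real.log (u ^ 2) ≤ u ^ 2 * (2 * (u - 1)) := by
      rw [Real.log_pow]
      exact mul_le_mul_of_nonneg_left (by push_cast; linarith) (sq_nonneg u)
    have h3 : u ^ 2 * (2 * (u - 1)) - u ^ 2 + 1 = (u - 1) ^ 2 * (2 * u + 1) := by ring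
    have h5 : (u - 1) ^ 2 * (2 * u + 1) ≤ (u - 1) ^ 2 * 9 :=
      mul_le_mul_of_nonneg_left (by linarith) (sq_nonneg _)
    have := Finset.sum_nonneg hS
    linarith
  · obtain ⟨n, hn, hn'⟩ := exists_nat_pow_near (show (1 : ℝ) ≤ u by linarith) one_lt_two
    have hn2 : 2 ≤ n := by
      by_contra h
      have : (2 : ℝ) ^ (n + 1) ≤ 2 ^ 2 := pow_le_pow_right₀ one_le_two (by omega)
      linarith
    -- One level below the dyadic level of u, the slice has its full height 2 ^ k, comparable to u;
    -- n ≥ 2 keeps the weight k at least 1.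
    obtain ⟨k, rfl⟩ : ∃ k, n = k + 1 := ⟨n - 1, by omega⟩
    have hkK : k < K := by
      have := (pow_lt_pow_iff_right₀ (one_lt_two (α := ℝ))).1 (hn.trans_lt huK)
      omega
    have hk1 : (1 : ℝ) ≤ k := by exact_mod_cast (by omega : 1 ≤ k)
    have h1 := Finset.single_le_sum hS (Finset.mem_range.2 hkK)
    rw [slice_of_le hn] at h1
    have h2 : Real.log (u ^ 2) ≤ 6 * k := by
      have h3 : Real.log u ≤ (k + 2) * Real.log 2 := by
        have := Real.log_le_log hu0 hn'.le
        rw [Real.log_pow] at this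
        push_cast at this
        linarith
      rw [Real.log_pow]
      push_cast
      nlinarith [Real.log_two_lt_d9]
    have h3 : u ^ 2 ≤ 16 * (2 ^ k) ^ 2 := by
      have := pow_le_pow_left₀ hu hn'.le 2
      calc u ^ 2 ≤ (2 ^ (k + 1 + 1)) ^ 2 := this
        _ = 16 * (2 ^ k) ^ 2 := by ring
    have h5 : u ^ 2 * Real.log (u ^ 2) ≤ 16 * (2 ^ k) ^ 2 * (6 * k) :=
      (mul_le_mul_of_nonneg_left h2 (sq_nonneg u)).trans
        (mul_le_mul_of_nonneg_right h3 (by positivity))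
    nlinarith [sq_nonneg (u - 1)]

theorem mass_lt_le_of_scalar_eq_one (hm : ∀ x, 0 ≤ m x) {f : V → ℝ} (hf1 : scalar m f f = 1)
    {a : ℝ} (ha : 0 < a) : mass m {x | a < f x} ≤ (a ^ 2)⁻¹ := by
  rw [scalar_self] at hf1
  rw [← one_div, le_div_iff₀ (by positivity), ← hf1, mass, Finset.sum_mul]
  refine Finset.sum_le_sum fun x _ => ?_
  by_cases hx : a < f x
  · rw [Set.indicator_of_mem (show x ∈ {x | a < f x} from hx), mul_comm]
    exact mul_le_mul_of_nonneg_right (pow_le_pow_left₀ ha.le hx.le 2) (hm x)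
  · rw [Set.indicator_of_notMem (show x ∉ {x | a < f x} from hx), zero_mul]
    exact mul_nonneg (sq_nonneg _) (hm x)

/-- By Chebyshev the slice lives on a set of mass at most 4⁻ᵏ, and log 4ᵏ ≥ k. For k = 0 the weight
is zero. -/
theorem logSpectralConst_mul_slice_le (hm : ∀ x, 0 ≤ m x) (hm1 : ∑ x, m x = 1)
    (hr : G.IsReversible m) {f : V → ℝ} (hf1 : scalar m f f = 1) (k : ℕ) :
    G.logSpectralConst m * (k * ∑ x, slice k (f x) ^ 2 * m x) ≤
      16 * G.dirichletForm m (fun x => slice k (f x)) (fun x => slice k (f x)) := by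
  rcases Nat.eq_zero_or_pos k with rfl | hk
  · have := dirichletForm_nonneg hm hr (fun x => slice 0 (f x))
    simpa using this
  rw [← scalar_self m (fun x => slice k (f x))]
  have hp : (0 : ℝ) < ((2 ^ k) ^ 2)⁻¹ := by positivity
  have hp1 : (((2 : ℝ) ^ k) ^ 2)⁻¹ ≤ 1 / 2 := by
    rw [one_div]
    refine inv_anti₀ two_pos ?_
    rw [← pow_mul]
    exact le_self_pow₀ one_le_two (by omega)
  have h1 := logSpectralConst_mul_neg_log_le hm hm1 hr (g := fun x => slice k (f x))
    (fun x => slice_nonneg k _) hp hp1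
    (by simpa only [slice_pos_iff] using mass_lt_le_of_scalar_eq_one hm hf1 (by positivity))
  have h2 : (k : ℝ) ≤ -Real.log (((2 : ℝ) ^ k) ^ 2)⁻¹ := by
    rw [Real.log_inv, neg_neg, Real.log_pow, Real.log_pow]
    push_cast
    nlinarith [Real.log_two_gt_d9, (Nat.cast_nonneg k : (0 : ℝ) ≤ k)]
  have h3 := mul_le_mul_of_nonneg_left h2 (mul_nonneg (logSpectralConst_nonneg hm hr)
    (scalar_self_nonneg hm (fun x => slice k (f x))))
  linarith

/-- The log-Sobolev inequality for nonnegative functions. -/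
theorem logSpectralConst_mul_entropy_le [Nonempty V] (hm : ∀ x, 0 ≤ m x) (hm1 : ∑ x, m x = 1)
    (hr : G.IsReversible m) {f : V → ℝ} (hf : ∀ x, 0 ≤ f x) (hf1 : scalar m f f = 1) :
    G.logSpectralConst m * entropy m (fun x => f x ^ 2) ≤ 2688 * G.dirichletForm m f f := by
  have hκ := logSpectralConst_nonneg hm hr
  obtain ⟨K, hK⟩ : ∃ K : ℕ, ∀ x, f x < 2 ^ K := by
    obtain ⟨x₀, hx₀⟩ := Finite.exists_max f
    obtain ⟨K, hK⟩ := pow_unbounded_of_one_lt (f x₀) one_lt_two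
    exact ⟨K, fun x => (hx₀ x).trans_lt hK⟩
  obtain ⟨a, ha⟩ := logSpectralConst_mul_variance_le hm hm1 hr f
  have hf2 : ∑ x, f x ^ 2 * m x = 1 := by rw [← scalar_self, hf1]
  have hexp : ∀ c : ℝ, ∑ x, (f x - c) ^ 2 * m x = 1 - 2 * c * (∑ x, f x * m x) + c ^ 2 := by
    intro c
    have : ∀ x, (f x - c) ^ 2 * m x = f x ^ 2 * m x - 2 * c * (f x * m x) + c ^ 2 * m x :=
      fun x => by ring
    simp only [this]
    rw [Finset.sum_add_distrib, Finset.sum_sub_distrib, ← Finset.mul_sum, ← Finset.mul_sum, hf2,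
      hm1, mul_one]
  -- With mean μ ∈ [0, 1], the left side is 2 - 2μ, and ∑ (f - a)² m ≥ 1 - μ² ≥ 1 - μ; f ≥ 0 enters
  -- through μ ≥ 0.
  have hvar : ∑ x, (f x - 1) ^ 2 * m x ≤ 2 * ∑ x, (f x - a) ^ 2 * m x := by
    have h0 : 0 ≤ ∑ x, (f x - 1) ^ 2 * m x :=
      Finset.sum_nonneg fun x _ => mul_nonneg (sq_nonneg _) (hm x)
    have h1 : 0 ≤ ∑ x, f x * m x := Finset.sum_nonneg fun x _ => mul_nonneg (hf x) (hm x)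
    rw [hexp] at h0 ⊢
    rw [hexp]
    nlinarith [sq_nonneg (a - ∑ x, f x * m x)]
  have hent : entropy m (fun x => f x ^ 2) ≤ 9 * ∑ x, (f x - 1) ^ 2 * m x +
      96 * ∑ k ∈ Finset.range K, k * ∑ x, slice k (f x) ^ 2 * m x := by
    have h1 : ∑ x, (f x ^ 2 * Real.log (f x ^ 2) - f x ^ 2 + 1) * m x =
        entropy m (fun x => f x ^ 2) := by
      simp only [add_mul, sub_mul, one_mul]
      rw [Finset.sum_add_distrib, Finset.sum_sub_distrib, hf2, hm1]
      simp [entropy, scalar]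
    have h2 : ∑ k ∈ Finset.range K, k * ∑ x, slice k (f x) ^ 2 * m x =
        ∑ x, (∑ k ∈ Finset.range K, k * slice k (f x) ^ 2) * m x := by
      simp only [Finset.mul_sum, Finset.sum_mul]
      rw [Finset.sum_comm]
      exact Finset.sum_congr rfl fun x _ => Finset.sum_congr rfl fun k _ => by ring
    rw [← h1, h2, Finset.mul_sum, Finset.mul_sum, ← Finset.sum_add_distrib]
    refine Finset.sum_le_sum fun x _ => ?_
    have := mul_le_mul_of_nonneg_right (sq_mul_log_sq_le (hf x) (hK x)) (hm x)
    linarith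
  have hslice : G.logSpectralConst m *
      ∑ k ∈ Finset.range K, k * ∑ x, slice k (f x) ^ 2 * m x ≤ 16 * G.dirichletForm m f f := by
    have h1 := sum_dirichletForm_le hm hr (Finset.range K) (fun k x => slice k (f x)) f
      (fun x y => sum_slice_sub_sq_le K (f x) (f y))
    rw [Finset.mul_sum]
    refine (Finset.sum_le_sum fun k _ =>
      logSpectralConst_mul_slice_le hm hm1 hr hf1 k).trans ?_
    rw [← Finset.mul_sum]
    linarith
  have h1 := mul_le_mul_of_nonneg_left hent hκ
  have h2 := mul_le_mul_of_nonneg_left hvar hκ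
  -- The constant is 2688 = 9 · 2 · 64 + 96 · 16.
  linarith

theorem logSpectralConst_le_logSobolevConst [Nontrivial V] (hm : ∀ x, 0 < m x)
    (hm1 : ∑ x, m x = 1) (hr : G.IsReversible m) :
    G.logSpectralConst m ≤ 2688 * G.logSobolevConst m := by
  have hm0 : ∀ x, 0 ≤ m x := fun x => (hm x).le
  suffices G.logSpectralConst m / 2688 ≤ G.logSobolevConst m by linarith
  refine le_csInf ?_ ?_
  -- The infimum must range over a nonempty set: a function on a single point of mass below 1 has
  -- positive entropy.
  · obtain ⟨x, y, hxy⟩ := exists_pair_ne V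
    have hX : ({x} : Set V).Nonempty := ⟨x, rfl⟩
    obtain ⟨f, hf, hfX⟩ := exists_norm2_eq_one hm hX
    have h1 := neg_log_mass_le_entropy hm hX hf hfX
    have h2 := (mass_add_compl m {x}).trans hm1
    have h3 := mass_pos hm (show ({x}ᶜ : Set V).Nonempty from ⟨y, hxy.symm⟩)
    have h4 := Real.log_neg (mass_pos hm hX) (by linarith)
    exact ⟨_, f, hf, by linarith, rfl⟩
  · rintro r ⟨f, hf, hpos, rfl⟩
    rw [norm2_eq_one_iff] at hf
    have h1 := logSpectralConst_mul_entropy_le hm0 hm1 hr (f := fun x => |f x|)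
      (fun x => abs_nonneg _) (by simpa only [scalar_self, sq_abs] using hf)
    simp only [sq_abs] at h1
    have h2 := dirichletForm_le_of_abs_sub_le hm0 hr (g := fun x => |f x|) (f := f)
      (fun x y => abs_abs_sub_abs_le_abs_sub _ _)
    rw [le_div_iff₀ hpos]
    linarith

end Comparison

end MarkovChain

theorem mainTheorem6 :
    ∃ c C : ℝ, 0 < c ∧ 0 < C ∧
      ∀ (V : Type*) [Fintype V] [Nontrivial V] (G : MarkovChain V) (m : V → ℝ),
        G.Connected → G.IsInvariant m → G.IsReversible m →
          c * G.logSobolevConst m ≤ G.logSpectralConst m ∧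
            G.logSpectralConst m ≤ C * G.logSobolevConst m := by
  refine ⟨1 / 4, 2688, by norm_num, by norm_num, fun V _ _ G m hG hm hr => ⟨?_, ?_⟩⟩
  · linarith [MarkovChain.logSobolevConst_le_logSpectralConst (hm.pos hG hr) hm.sum_eq_one hr]
  · exact MarkovChain.logSpectralConst_le_logSobolevConst (hm.pos hG hr) hm.sum_eq_one hr
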